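/- Fix integers $n,\ell\ge 0$. Let $\mathcal G$ be the set of all undirected simple graphs $G=(V_G,E_G,\mathsf{col}_G)$ with vertex set $V_G=[n]$ and vertex-labelling $\mathsf{col}_G:V_G\to\mathbb R^\ell$, and let $\mathcal G_1$ be the set of pairs $(G,v)$ with $G\in\mathcal G$, $v\in V_G$. For a set $\mathcal F$ of functions on $\mathcal G_1$, let $\rho_1(\mathcal F)$ be the equivalence relation on $\mathcal G_1$ with $((G,v),(H,w))\in\rho_1(\mathcal F)$ iff $f(G,v)=f(H,w)$ for all $f\in\mathcal F$. Weisfeiler-Leman. For $k\ge 1$ and $\boldsymbol v\in V_G^k$, the atomic type $\mathsf{atp}_k(G,\boldsymbol v)$ is the vector consisting of the $0/1$-values telling whether $v_i=v_j$ ($i<j$), the $0/1$-values telling whether $v_iv_j\in E_G$ ($i<j$), and the labels $\mathsf{col}_G(v_i)$, $i\in[k]$. Let $\mathsf{wl}_k^{(0)}(G,\boldsymbol v):=\mathsf{atp}_k(G,\boldsymbol v)$ and $$\mathsf{wl}_k^{(t+1)}(G,\boldsymbol v):=\Bigl(\mathsf{wl}_k^{(t)}(G,\boldsymbol v),\{\!\{(\mathsf{atp}_{k+1}(G,\boldsymbol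 v u),\mathsf{wl}_k^{(t)}(G,\boldsymbol v[u/1]),\ldots,\mathsf{wl}_k^{(t)}(G,\boldsymbol v[u/k]))\mid u\in V_G\}\!\}\Bigr),$$ where $\boldsymbol v[u/i]$ is $\boldsymbol v$ with its $i$-th entry replaced by $u$. Put $\mathsf{vwl}_k^{(t)}(G,v):=\mathsf{wl}_k^{(t)}(G,(v,\ldots,v))$. Tensor language. Let $\Omega$ be a collection of functions $f:\mathbb R^p\to\mathbb R$, of arbitrary arities $p$. Expressions of $\mathsf{TL}_{k+1}(\Omega)$ are generated by $$\varphi:=\mathbf 1_{x=y}\mid\mathbf 1_{x\ne y}\mid E(x,y)\mid P_s(x)\mid\varphi\cdot\varphi\mid\varphi+\varphi\mid a\cdot\varphi\mid f(\varphi,\ldots,\varphi)\mid\textstyle\sum_x\varphi,$$ with index variables $x,y\in\{x_1,\ldots,x_{k+1}\}$, $s\in[\ell]$, $a\in\mathbb R$, $f\in\Omega$. In a graph $G$ under a valuation $\nu$ of the index variables by vertices, $\mathbf 1_{x=y}$, $\mathbf 1_{x\neq y}$ and $E(x,y)$ are the indicators of $\nu(x)=\nu(y)$, $\nu(x)\ne\nu(y)$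 and $\nu(x)\nu(y)\in E_G$; $P_s(x)$ is $\mathsf{col}_G(\nu(x))_s$; products, sums, scalar multiples and function applications are evaluated pointwise; and $\sum_x\varphi$ is $\sum_{v\in V_G}$ of the value of $\varphi$ under $\nu[x\mapsto v]$. The only variable-binding operation is $\sum_x$, and the summation depth of an expression is the maximal nesting depth of the summations $\sum_x$ in it. Let $\mathsf{TL}_{k+1}^{(t)}(\Omega)$ be the set of expressions of $\mathsf{TL}_{k+1}(\Omega)$ of summation depth at most $t$, and let $\rho_1(\mathsf{TL}_{k+1}^{(t)}(\Omega))$ be $\rho_1(\mathcal F)$ for the set $\mathcal F$ of all functions $\mathcal G_1\to\mathbb R^d$, $d\in\mathbb N$, of the form $(G,v)\mapsto$ (values in $G$ at $x_1\mapsto v$ of $\varphi_1,\ldots,\varphi_d$), with $\varphi_1,\ldots,\varphi_d\in\mathsf{TL}_{k+1}^{(t)}(\Omega)$ whose only free index variable is $x_1$. Theorem. For all $t\ge 0$, all $k\ge 1$ and every collection $\Omega$ of functions, $$\rho_1\bigl(\mathsf{vwl}_k^{(t)}\bigr)=\rho_1\bigl(\mathsf{TL}_{k+1}^{(t)}(\Omega)\bigr).$$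 -/

import Mathlib

namespace TensorLang

/-! ### Vertex-labelled graphs -/

/-- Undirected simple graphs of size `n`, with vertex set `Fin n`, equipped with a
vertex-labelling with values in `ℝ^ℓ`. -/
structure LGraph (n ℓ : ℕ) where
  /-- the underlying undirected simple graph -/
  graph : SimpleGraph (Fin n)
  /-- the vertex-labelling -/
  col : Fin n → Fin ℓ → ℝ

/-- The set `𝒢₁` of pairs `(G, v)` of a graph of size `n` and a vertex of it. -/
abbrev PGraph (n ℓ : ℕ) : Type := LGraph n ℓ × Fin n

/-! ### Separation power -/

/-- The equivalence relation `ρ₁(F)` on `𝒢₁` defined by a family `F` of functions on `𝒢₁`: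
two pairs are related if and only if no function of the family separates them. -/
def rho1 {n ℓ : ℕ} {ι : Type*} {L : ι → Type*} (F : (i : ι) → PGraph n ℓ → L i) :
    Setoid (PGraph n ℓ) where
  r p q := ∀ i, F i p = F i q
  iseqv :=
    { refl := fun _ _ => rfl
      symm := fun h i => (h i).symm
      trans := fun h h' i => (h i).trans (h' i) }

/-! ### The (folklore) `k`-dimensional Weisfeiler-Leman algorithm -/

/-- Pairs `i < j` of positions in a `k`-tuple. -/
abbrev PosPair (k : ℕ) : Type := {p : Fin k × Fin k // p.1 < p.2}

/-- Values of atomic types of `k`-tuples: equality entries, adjacency entries, and the labels of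
the `k` components. -/
abbrev AtomicType (k ℓ : ℕ) : Type :=
  (PosPair k → ℝ) × (PosPair k → ℝ) × (Fin k → Fin ℓ → ℝ)

open Classical in
/-- The atomic type of a `k`-tuple `v` of vertices of `G`. -/
noncomputable def atp {n ℓ k : ℕ} (G : LGraph n ℓ) (v : Fin k → Fin n) : AtomicType k ℓ :=
  (fun p => if v p.1.1 = v p.1.2 then 1 else 0,
   fun p => if G.graph.Adj (v p.1.1) (v p.1.2) then 1 else 0,
   fun i => G.col (v i))

/-- The labels that `t` rounds of `k`-WL assign to `k`-tuples. -/
def WLLabel (k ℓ : ℕ) : ℕ → Type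
  | 0 => AtomicType k ℓ
  | t + 1 => WLLabel k ℓ t × Multiset (AtomicType (k + 1) ℓ × (Fin k → WLLabel k ℓ t))

/-- The label of the `k`-tuple `v` of vertices of `G` after `t` rounds of `k`-WL. Here
`Fin.snoc v u` is the `(k+1)`-tuple `v u` and `Function.update v i u` is `v[u/i]`. -/
noncomputable def wl {n ℓ : ℕ} (k : ℕ) (G : LGraph n ℓ) :
    (t : ℕ) → (Fin k → Fin n) → WLLabel k ℓ t
  | 0, v => atp G v
  | t + 1, v =>
    (wl k G t v,
      (Finset.univ : Finset (Fin n)).val.map fun u =>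
        (atp G (Fin.snoc v u : Fin (k + 1) → Fin n),
         fun i : Fin k => wl k G t (Function.update v i u)))

/-- The vertex-labelling `(G, v) ↦ wl_k^(t)(G, (v, …, v))`. -/
noncomputable def vwl {n ℓ : ℕ} (k t : ℕ) (p : PGraph n ℓ) : WLLabel k ℓ t :=
  wl k p.1 t fun _ => p.2

/-! ### Tensor language -/

/-- Tensor language expressions `TL(Ω)` with index variables from `X`, for graphs with labels in
`ℝ^ℓ`. The collection `Ω` of functions is given by its sets `Ω p` of functions `ℝ^p → ℝ`. -/
inductive Expr (ℓ : ℕ) (Ω : (p : ℕ) → Set ((Fin p → ℝ) → ℝ)) (X : Type) : Type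
  /-- `1_{x = y}` -/
  | eq (x y : X) : Expr ℓ Ω X
  /-- `1_{x ≠ y}` -/
  | ne (x y : X) : Expr ℓ Ω X
  /-- `E(x, y)` -/
  | edge (x y : X) : Expr ℓ Ω X
  /-- `P_s(x)` -/
  | lab (s : Fin ℓ) (x : X) : Expr ℓ Ω X
  /-- `φ · ψ` -/
  | mul (φ ψ : Expr ℓ Ω X) : Expr ℓ Ω X
  /-- `φ + ψ` -/
  | add (φ ψ : Expr ℓ Ω X) : Expr ℓ Ω X
  /-- `a · φ` -/
  | smul (a : ℝ) (φ : Expr ℓ Ω X) : Expr ℓ Ω X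
  /-- `f(φ₁, …, φ_p)` -/
  | app (p : ℕ) (f : (Fin p → ℝ) → ℝ) (hf : f ∈ Ω p) (φ : Fin p → Expr ℓ Ω X) : Expr ℓ Ω X
  /-- `∑_x φ` -/
  | sum (x : X) (φ : Expr ℓ Ω X) : Expr ℓ Ω X

namespace Expr

variable {ℓ : ℕ} {Ω : (p : ℕ) → Set ((Fin p → ℝ) → ℝ)} {X : Type}

/-- The set of free index variables. -/
def free : Expr ℓ Ω X → Set X
  | eq x y => {x, y}
  | ne x y => {x, y}
  | edge x y => {x, y}
  | lab _ x => {x}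
  | mul φ ψ => φ.free ∪ ψ.free
  | add φ ψ => φ.free ∪ ψ.free
  | smul _ φ => φ.free
  | app _ _ _ φ => ⋃ i, (φ i).free
  | sum x φ => φ.free \ {x}

/-- The summation depth. -/
def sd : Expr ℓ Ω X → ℕ
  | eq _ _ => 0
  | ne _ _ => 0
  | edge _ _ => 0
  | lab _ _ => 0
  | mul φ ψ => max φ.sd ψ.sd
  | add φ ψ => max φ.sd ψ.sd
  | smul _ φ => φ.sd
  | app _ _ _ φ => Finset.univ.sup fun i => (φ i).sd
  | sum _ φ => φ.sd + 1

open Classical in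
/-- The value of an expression in the graph `G` under the valuation `ν`. -/
noncomputable def eval {n : ℕ} (G : LGraph n ℓ) : Expr ℓ Ω X → (X → Fin n) → ℝ
  | eq x y, ν => if ν x = ν y then 1 else 0
  | ne x y, ν => if ν x ≠ ν y then 1 else 0
  | edge x y, ν => if G.graph.Adj (ν x) (ν y) then 1 else 0
  | lab s x, ν => G.col (ν x) s
  | mul φ ψ, ν => φ.eval G ν * ψ.eval G ν
  | add φ ψ, ν => φ.eval G ν + ψ.eval G ν
  | smul a φ, ν => a * φ.eval G ν
  | app _ f _ φ, ν => f fun i => (φ i).eval G ν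
  | sum x φ, ν => ∑ v : Fin n, φ.eval G (Function.update ν x v)

end Expr

/-- The fragment `TL_m^(t)(Ω)`: expressions that only use the index variables `x₁, …, x_m`
(here the elements of `Fin m`), of summation depth at most `t`. -/
def TLFrag (ℓ m t : ℕ) (Ω : (p : ℕ) → Set ((Fin p → ℝ) → ℝ)) : Set (Expr ℓ Ω (Fin m)) :=
  {φ | φ.sd ≤ t}

/-- The function `f : 𝒢₁ → ℝ^d` can be represented in the fragment `𝓛` by `d` expressions with
one free index variable `x`. -/
def Represented {n ℓ : ℕ} {Ω : (p : ℕ) → Set ((Fin p → ℝ) → ℝ)} {X : Type}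
    (𝓛 : Set (Expr ℓ Ω X)) (x : X) {d : ℕ} (f : PGraph n ℓ → Fin d → ℝ) : Prop :=
  ∃ φ : Fin d → Expr ℓ Ω X,
    (∀ j, φ j ∈ 𝓛 ∧ (φ j).free = {x}) ∧
      ∀ (G : LGraph n ℓ) (v : Fin n) (ν : X → Fin n), ν x = v →
        ∀ j, f (G, v) j = (φ j).eval G ν

/-- The vector-valued functions on `𝒢₁` that can be represented in the fragment `𝓛`. -/
abbrev RepresentedFun (n : ℕ) {ℓ : ℕ} {Ω : (p : ℕ) → Set ((Fin p → ℝ) → ℝ)} {X : Type}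
    (𝓛 : Set (Expr ℓ Ω X)) (x : X) : Type :=
  {f : Σ d : ℕ, (PGraph n ℓ → Fin d → ℝ) // Represented 𝓛 x f.2}

/-- The equivalence relation `ρ₁(𝓛)` on `𝒢₁` of a fragment `𝓛`: the one defined by all functions
that can be represented in it. -/
def rho1Frag (n : ℕ) {ℓ : ℕ} {Ω : (p : ℕ) → Set ((Fin p → ℝ) → ℝ)} {X : Type}
    (𝓛 : Set (Expr ℓ Ω X)) (x : X) : Setoid (PGraph n ℓ) :=
  rho1 fun f : RepresentedFun n 𝓛 x => f.1.2

end TensorLang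

/-! The theorem consists of two inclusions.

*Weisfeiler-Leman bounds tensor language.* If two valuations `ν`, `μ` of the `k + 1` variables have
the same atomic type, and all `k`-tuples read off from them have the same label after `t` rounds,
then all expressions of summation depth at most `t` take the same value on them
(`Expr.eval_eq_of_wl_eq`). For `∑_x φ`, equality of labels after `t + 1` rounds gives a bijection
`u ↦ e u` of the vertices, and `ν[x ↦ u]`, `μ[x ↦ e u]` satisfy the hypothesis for `t`. This uses
that the label of `v` determines the label of `v ∘ τ` for every map `τ` of the positions
(`wl_comp_eq`), since the label records the `k`-tuples in one order only.

*Tensor language bounds Weisfeiler-Leman.* On a finite family of graphs, the functions represented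
by expressions of depth at most `t` with free variables in a nonempty set `S` form a subalgebra
`exprAlgebra` of a finite power of `ℝ`. Such a subalgebra contains every function which is constant
on the classes of points it does not separate (`Subalgebra.mem_of_forall_eq`), whence no functions
from `Ω` are needed. By induction on `t`, it separates the tuples with different labels
(`wl_eq_of_exprAlgebra`): the multiplicity of a value in the multiset of a round is `∑_{x_j}` of the
indicator function of this value, where `x_j` is a variable not used by the `k`-tuple, and this
indicator function belongs to the subalgebra of the previous depth. -/

namespace TensorLang

/-! ### Labels of tuples under change of positions -/

theorem exists_forall_apply_ne {k : ℕ} (σ : Fin k → Fin (k + 1)) : ∃ j, ∀ a, σ a ≠ j := by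
  by_contra! hcon
  have := Fintype.card_le_of_surjective σ hcon
  simp at this

section WL

variable {n ℓ k : ℕ} {G H : LGraph n ℓ}

theorem ite_one_zero_eq_iff {p q : Prop} [Decidable p] [Decidable q] :
    ((if p then (1 : ℝ) else 0) = if q then 1 else 0) ↔ (p ↔ q) := by
  by_cases hp : p <;> by_cases hq : q <;> simp [hp, hq]

theorem atp_eq_iff {v w : Fin k → Fin n} :
    atp G v = atp H w ↔
      (∀ i j, v i = v j ↔ w i = w j) ∧
      (∀ i j, G.graph.Adj (v i) (v j) ↔ H.graph.Adj (w i) (w j)) ∧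
      ∀ i, G.col (v i) = H.col (w i) := by
  simp only [atp, Prod.mk.injEq, funext_iff (f := fun p : PosPair k => _), ite_one_zero_eq_iff,
    Subtype.forall, Prod.forall]
  refine and_congr ⟨fun h i j => ?_, fun h i j _ => h i j⟩
    (and_congr ⟨fun h i j => ?_, fun h i j _ => h i j⟩ funext_iff)
  · rcases lt_trichotomy i j with hij | rfl | hij
    · exact h i j hij
    · simp
    · rw [eq_comm, h j i hij, eq_comm]
  · rcases lt_trichotomy i j with hij | rfl | hij
    · exact h i j hij
    · simp
    · rw [G.graph.adj_comm, h j i hij, H.graph.adj_comm]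

theorem atp_comp_eq {m : ℕ} {v w : Fin k → Fin n} (h : atp G v = atp H w) (τ : Fin m → Fin k) :
    atp G (v ∘ τ) = atp H (w ∘ τ) := by
  rw [atp_eq_iff] at h ⊢
  exact ⟨fun i j => h.1 _ _, fun i j => h.2.1 _ _, fun i => h.2.2 _⟩

theorem map_univ_eq_map_univ_iff {α β : Type*} [Fintype α] {f g : α → β} :
    (Finset.univ : Finset α).val.map f = (Finset.univ : Finset α).val.map g ↔
      ∃ e : Equiv.Perm α, ∀ a, f a = g (e a) := by
  classical
  constructor
  · intro h
    have hcard : ∀ b, Nonempty ({a // f a = b} ≃ {a // g a = b}) := by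
      intro b
      have hb := congrArg (Multiset.count b) h
      rw [Multiset.count_map, Multiset.count_map] at hb
      refine ⟨Fintype.equivOfCardEq ?_⟩
      rw [Fintype.card_subtype, Fintype.card_subtype]
      simp only [eq_comm (a := b)] at hb
      exact hb
    exact ⟨Equiv.ofFiberEquiv fun b => (hcard b).some,
      fun a => (Equiv.ofFiberEquiv_map _ a).symm⟩
  · rintro ⟨e, he⟩
    rw [funext he, ← Function.comp_def g e, ← Multiset.map_map, Multiset.map_univ_val_equiv]

theorem natCast_count_map_univ {α β : Type*} [Fintype α] [DecidableEq β] (f : α → β) (b : β) :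
    ((Multiset.count b ((Finset.univ : Finset α).val.map f) : ℕ) : ℝ) =
      ∑ a, if f a = b then 1 else 0 := by
  rw [Multiset.count_map]
  simp only [eq_comm (a := b)]
  exact Finset.natCast_card_filter (fun a => f a = b) Finset.univ

theorem wl_succ_eq_iff {t : ℕ} {v w : Fin k → Fin n} :
    wl k G (t + 1) v = wl k H (t + 1) w ↔
      wl k G t v = wl k H t w ∧ ∃ e : Equiv.Perm (Fin n), ∀ u,
        atp G (Fin.snoc v u : Fin (k + 1) → Fin n) = atp H (Fin.snoc w (e u)) ∧
        ∀ i, wl k G t (Function.update v i u) = wl k H t (Function.update w i (e u)) := by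
  refine (Prod.ext_iff (α := WLLabel k ℓ t)).trans (and_congr Iff.rfl ?_)
  refine (map_univ_eq_map_univ_iff (α := Fin n)
    (f := fun u => ((atp G (Fin.snoc v u) : AtomicType (k + 1) ℓ),
      fun i => wl k G t (Function.update v i u)))
    (g := fun u => (atp H (Fin.snoc w u),
      fun i => wl k H t (Function.update w i u)))).trans (exists_congr fun e => ?_)
  exact forall_congr' fun u => Prod.ext_iff.trans (and_congr Iff.rfl funext_iff)

theorem atp_eq_of_wl_eq {t : ℕ} {v w : Fin k → Fin n} (h : wl k G t v = wl k H t w) :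
    atp G v = atp H w := by
  induction t with
  | zero => exact h
  | succ t ih => exact ih (wl_succ_eq_iff.1 h).1

/-- The label of a tuple determines the labels of all tuples made of its entries. -/
theorem wl_comp_eq {t : ℕ} {v w : Fin k → Fin n} (h : wl k G t v = wl k H t w)
    (τ : Fin k → Fin k) : wl k G t (v ∘ τ) = wl k H t (w ∘ τ) := by
  induction t generalizing v w τ with
  | zero => exact atp_comp_eq h τ
  | succ t ih =>
    obtain ⟨h0, e, he⟩ := wl_succ_eq_iff.1 h
    refine wl_succ_eq_iff.2 ⟨ih h0 τ, e, fun u => ⟨?_, fun i => ?_⟩⟩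
    · have hs : ∀ (x : Fin k → Fin n) (u : Fin n), (Fin.snoc (x ∘ τ) u : Fin (k + 1) → Fin n) =
          (Fin.snoc x u : Fin (k + 1) → Fin n) ∘
            (Fin.snoc (fun a => (τ a).castSucc) (Fin.last k) : Fin (k + 1) → Fin (k + 1)) := by
        intro x u
        funext a
        refine Fin.lastCases ?_ (fun a => ?_) a <;> simp
      rw [hs, hs]
      exact atp_comp_eq (he u).1 _
    · -- The entry replaced at position `i` can be stored at a position `m` not read elsewhere.
      obtain ⟨m, hm⟩ : ∃ m, ∀ a, a ≠ i → τ a ≠ m := by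
        by_contra! hcon
        choose g hg hgτ using hcon
        have hinj : Function.Injective g := fun a b hab => by rw [← hgτ a, ← hgτ b, hab]
        obtain ⟨a, ha⟩ := Finite.surjective_of_injective hinj i
        exact hg a ha
      have hs : ∀ (x : Fin k → Fin n) (u : Fin n), Function.update (x ∘ τ) i u =
          Function.update x m u ∘ Function.update τ i m := by
        intro x u
        funext a
        by_cases ha : a = i
        · subst ha; simp
        · simp [ha, hm a ha]
      rw [hs, hs]
      exact ih ((he u).2 m) _

end WL

/-! ### Weisfeiler-Leman bounds tensor language -/

namespace Expr

variable {n ℓ k : ℕ} {Ω : (p : ℕ) → Set ((Fin p → ℝ) → ℝ)} {G H : LGraph n ℓ}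

/-- Replacing the value of `x` in matching valuations by corresponding vertices `u`, `u'` of a
round of Weisfeiler-Leman at the `k`-tuples of the other variables gives matching valuations. -/
theorem wl_update_comp_eq {t : ℕ} {ν μ : Fin (k + 1) → Fin n} {x : Fin (k + 1)} {u u' : Fin n}
    (hwl : ∀ σ : Fin k → Fin (k + 1), wl k G t (ν ∘ σ) = wl k H t (μ ∘ σ))
    (hu : ∀ i, wl k G t (Function.update (ν ∘ x.succAbove) i u) =
      wl k H t (Function.update (μ ∘ x.succAbove) i u'))
    (σ : Fin k → Fin (k + 1)) :
    wl k G t (Function.update ν x u ∘ σ) = wl k H t (Function.update μ x u' ∘ σ) := by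
  obtain ⟨j, hj⟩ := exists_forall_apply_ne σ
  by_cases hjx : j = x
  · subst hjx
    have hs : ∀ (η : Fin (k + 1) → Fin n) (u : Fin n), Function.update η j u ∘ σ = η ∘ σ := by
      intro η u
      funext a
      simp [hj a]
    rw [hs, hs]
    exact hwl σ
  · obtain ⟨i, rfl⟩ := Fin.exists_succAbove_eq hjx
    have hτ : ∀ a, ∃ b, Function.update x.succAbove i x b = σ a := by
      intro a
      by_cases hax : σ a = x
      · exact ⟨i, by simp [hax]⟩
      · obtain ⟨b, hb⟩ := Fin.exists_succAbove_eq hax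
        have hbi : b ≠ i := by
          rintro rfl
          exact hj a hb.symm
        exact ⟨b, by simp [hbi, hb]⟩
    choose τ hτ using hτ
    have hs : ∀ (η : Fin (k + 1) → Fin n) (u : Fin n), Function.update η x u ∘ σ =
        Function.update (η ∘ x.succAbove) i u ∘ τ := by
      intro η u
      funext a
      simp only [Function.comp, ← hτ a]
      by_cases ha : τ a = i
      · simp [ha]
      · simp [ha, Fin.succAbove_ne]
    rw [hs, hs]
    exact wl_comp_eq (hu i) τ

theorem atp_update_eq {ν μ : Fin (k + 1) → Fin n} {x : Fin (k + 1)} {u u' : Fin n}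
    (hu : atp G (Fin.snoc (ν ∘ x.succAbove) u : Fin (k + 1) → Fin n) =
      atp H (Fin.snoc (μ ∘ x.succAbove) u')) :
    atp G (Function.update ν x u) = atp H (Function.update μ x u') := by
  have hρ : ∀ y, ∃ z, (Fin.snoc x.succAbove x : Fin (k + 1) → Fin (k + 1)) z = y := by
    intro y
    by_cases hy : y = x
    · exact ⟨Fin.last k, by simp [hy]⟩
    · obtain ⟨b, hb⟩ := Fin.exists_succAbove_eq hy
      exact ⟨b.castSucc, by simpa using hb⟩
  choose ρ hρ using hρ
  have hs : ∀ (η : Fin (k + 1) → Fin n) (u : Fin n), Function.update η x u =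
      (Fin.snoc (η ∘ x.succAbove) u : Fin (k + 1) → Fin n) ∘ ρ := by
    intro η u
    funext y
    conv_lhs => rw [← hρ y]
    simp only [Function.comp]
    refine Fin.lastCases ?_ (fun a => ?_) (ρ y) <;> simp [Fin.succAbove_ne]
  rw [hs, hs]
  exact atp_comp_eq hu ρ

/-- Expressions of depth at most `t` agree on valuations with the same atomic type all of whose
`k`-tuples of values have the same labels after `t` rounds. The atomic type of all `k + 1` values is
a separate hypothesis, since a relation between two of them is not visible in `k`-tuples if
`k = 1`. -/
theorem eval_eq_of_wl_eq (φ : Expr ℓ Ω (Fin (k + 1))) {t : ℕ} (hφ : φ.sd ≤ t)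
    {ν μ : Fin (k + 1) → Fin n} (hatp : atp G ν = atp H μ)
    (hwl : ∀ σ : Fin k → Fin (k + 1), wl k G t (ν ∘ σ) = wl k H t (μ ∘ σ)) :
    φ.eval G ν = φ.eval H μ := by
  have hatp' := atp_eq_iff.1 hatp
  induction φ generalizing t ν μ with
  | eq x y => simp only [eval, hatp'.1 x y]
  | ne x y => simp only [eval, ne_eq, hatp'.1 x y]
  | edge x y => simp only [eval]; congr 1; exact propext (hatp'.2.1 x y)
  | lab s x => simp only [eval, hatp'.2.2 x]
  | mul φ ψ ihφ ihψ =>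
    simp only [sd, max_le_iff] at hφ
    simp only [eval, ihφ hφ.1 hatp hwl hatp', ihψ hφ.2 hatp hwl hatp']
  | add φ ψ ihφ ihψ =>
    simp only [sd, max_le_iff] at hφ
    simp only [eval, ihφ hφ.1 hatp hwl hatp', ihψ hφ.2 hatp hwl hatp']
  | smul a φ ih =>
    simp only [eval, ih hφ hatp hwl hatp']
  | app p f hf φ ih =>
    simp only [sd, Finset.sup_le_iff, Finset.mem_univ, forall_const] at hφ
    simp only [eval]
    congr 1
    funext i
    exact ih i (hφ i) hatp hwl hatp'
  | sum x φ ih =>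
    simp only [sd] at hφ
    obtain ⟨t, rfl⟩ := Nat.exists_eq_add_of_le' ((Nat.le_add_left 1 _).trans hφ)
    obtain ⟨-, e, he⟩ := wl_succ_eq_iff.1 (hwl x.succAbove)
    simp only [eval]
    refine Fintype.sum_equiv e _ _ fun u => ?_
    have hu := atp_update_eq (he u).1
    convert ih (Nat.le_of_succ_le_succ hφ) hu
      (wl_update_comp_eq (fun σ => (wl_succ_eq_iff.1 (hwl σ)).1) (he u).2) (atp_eq_iff.1 hu)

theorem eval_congr {X : Type} (φ : Expr ℓ Ω X) {ν μ : X → Fin n}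
    (h : ∀ x ∈ φ.free, ν x = μ x) : φ.eval G ν = φ.eval G μ := by
  induction φ generalizing ν μ with
  | eq x y => simp only [eval, h x (Or.inl rfl), h y (Or.inr rfl)]
  | ne x y => simp only [eval, h x (Or.inl rfl), h y (Or.inr rfl)]
  | edge x y =>
    have hx := h x (Or.inl rfl)
    have hy := h y (Or.inr rfl)
    simp only [eval]
    rw [hx, hy]
  | lab s x => simp only [eval, h x rfl]
  | mul φ ψ ihφ ihψ =>
    simp only [eval, ihφ fun x hx => h x (Or.inl hx), ihψ fun x hx => h x (Or.inr hx)]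
  | add φ ψ ihφ ihψ =>
    simp only [eval, ihφ fun x hx => h x (Or.inl hx), ihψ fun x hx => h x (Or.inr hx)]
  | smul a φ ih => simp only [eval, ih h]
  | app p f hf φ ih =>
    simp only [eval]
    congr 1
    funext i
    exact ih i fun x hx => h x (Set.mem_iUnion_of_mem i hx)
  | sum x φ ih =>
    simp only [eval]
    refine Finset.sum_congr rfl fun u _ => ih fun y hy => ?_
    by_cases hyx : y = x
    · subst hyx; simp
    · simpa [hyx] using h y ⟨hy, hyx⟩

end Expr

/-! ### Subalgebras of finite powers of the reals -/

/-- A subalgebra of a finite power of `ℝ` contains the functions which are constant on the classes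
of points that it does not separate. -/
theorem _root_.Subalgebra.mem_of_forall_eq {P : Type*} [Finite P] (A : Subalgebra ℝ (P → ℝ))
    (g : P → ℝ) (hg : ∀ p q, (∀ f ∈ A, f p = f q) → g p = g q) : g ∈ A := by
  classical
  have := Fintype.ofFinite P
  let r : Setoid P :=
    { r := fun p q => ∀ f ∈ A, f p = f q
      iseqv := ⟨fun _ _ _ => rfl, fun h f hf => (h f hf).symm,
        fun h h' f hf => (h f hf).trans (h' f hf)⟩ }
  -- The indicator function of a class is a product of interpolation factors.
  have hind : ∀ p, (fun q => if r p q then (1 : ℝ) else 0) ∈ A := by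
    intro p
    have hfac : ∀ z, ∃ f ∈ A, (∀ q, r p q → f q = 1) ∧ (¬ r p z → f z = 0) := by
      intro z
      by_cases hz : r p z
      · exact ⟨1, A.one_mem, fun _ _ => rfl, fun h => absurd hz h⟩
      · have hz' : ¬ ∀ f ∈ A, f p = f z := hz
        push Not at hz'
        obtain ⟨f, hf, hne⟩ := hz'
        refine ⟨(f p - f z)⁻¹ • (f - algebraMap ℝ (P → ℝ) (f z)),
          A.smul_mem (A.sub_mem hf (A.algebraMap_mem _)) _, fun q hq => ?_, fun _ => ?_⟩
        · have : f p = f q := hq f hf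
          simp [← this, inv_mul_cancel₀ (sub_ne_zero.2 hne)]
        · simp
    choose F hF h1 h0 using hfac
    have hprod : (fun q => if r p q then (1 : ℝ) else 0) = ∏ z, F z := by
      funext q
      rw [Finset.prod_apply]
      split_ifs with hq
      · exact (Finset.prod_eq_one fun z _ => h1 z q hq).symm
      · exact (Finset.prod_eq_zero (f := fun z => F z q) (Finset.mem_univ q) (h0 q hq)).symm
    rw [hprod]
    exact A.prod_mem fun z _ => hF z
  -- Each point of a class contributes the indicator function of the class.
  have hsum : g = ∑ p, (g p / (Finset.univ.filter fun z => r p z).card) •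
      fun q => if r p q then (1 : ℝ) else 0 := by
    funext q
    rw [Finset.sum_apply]
    have hterm : ∀ p, ((g p / (Finset.univ.filter fun z => r p z).card) •
        fun q => if r p q then (1 : ℝ) else 0) q =
        if r q p then g q / (Finset.univ.filter fun z => r q z).card else 0 := by
      intro p
      by_cases hpq : r p q
      · have hc : (Finset.univ.filter fun z => r p z) = Finset.univ.filter fun z => r q z := by
          ext z
          simp only [Finset.mem_filter_univ]
          exact ⟨fun h => r.trans (r.symm hpq) h, fun h => r.trans hpq h⟩
        simp [hpq, r.symm hpq, hc, hg p q hpq]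
      · have : ¬ r q p := fun h => hpq (r.symm h)
        simp [hpq, this]
    rw [Finset.sum_congr rfl fun p _ => hterm p, ← Finset.sum_filter, Finset.sum_const,
      nsmul_eq_mul, mul_div_cancel₀]
    have : 0 < (Finset.univ.filter fun z => r q z).card :=
      Finset.card_pos.2 ⟨q, by simp⟩
    exact_mod_cast this.ne'
  rw [hsum]
  exact A.sum_mem fun p _ => A.smul_mem (hind p) _

/-! ### Tensor language bounds Weisfeiler-Leman -/

section Algebra

variable {n ℓ : ℕ} {ι X : Type} (Ω : (p : ℕ) → Set ((Fin p → ℝ) → ℝ)) (G : ι → LGraph n ℓ)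

/-- The algebra of the functions on pairs of a graph of the family `G` and a valuation which are
represented by expressions of summation depth at most `t` with free variables in `S`. A variable in
`S` is needed to write constants, as multiples of `1_{x = x}`. -/
def exprAlgebra (t : ℕ) (S : Set X) (hS : S.Nonempty) :
    Subalgebra ℝ (ι × (X → Fin n) → ℝ) where
  carrier := {f | ∃ φ : Expr ℓ Ω X, φ.sd ≤ t ∧ φ.free ⊆ S ∧ ∀ p, f p = φ.eval (G p.1) p.2}
  mul_mem' := by
    rintro f g ⟨φ, h1, h2, h3⟩ ⟨ψ, h1', h2', h3'⟩
    exact ⟨.mul φ ψ, max_le h1 h1', Set.union_subset h2 h2', fun p => by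
      simp [Expr.eval, h3, h3']⟩
  add_mem' := by
    rintro f g ⟨φ, h1, h2, h3⟩ ⟨ψ, h1', h2', h3'⟩
    exact ⟨.add φ ψ, max_le h1 h1', Set.union_subset h2 h2', fun p => by
      simp [Expr.eval, h3, h3']⟩
  algebraMap_mem' := by
    obtain ⟨x, hx⟩ := hS
    intro a
    exact ⟨.smul a (.eq x x), Nat.zero_le _, by simpa [Expr.free] using hx, fun p => by
      simp [Expr.eval]⟩

variable {Ω G}

theorem mem_exprAlgebra {t : ℕ} {S : Set X} {hS : S.Nonempty} {φ : Expr ℓ Ω X}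
    (hsd : φ.sd ≤ t) (hfree : φ.free ⊆ S) :
    (fun p => φ.eval (G p.1) p.2) ∈ exprAlgebra Ω G t S hS :=
  ⟨φ, hsd, hfree, fun _ => rfl⟩

theorem exprAlgebra_mono {s t : ℕ} {S T : Set X} {hS : S.Nonempty} {hT : T.Nonempty}
    (hst : s ≤ t) (hST : S ⊆ T) : exprAlgebra Ω G s S hS ≤ exprAlgebra Ω G t T hT := by
  rintro f ⟨φ, h1, h2, h3⟩
  exact ⟨φ, h1.trans hst, h2.trans hST, h3⟩

/-- Summation over a variable raises the depth by one and removes the variable. -/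
theorem sum_mem_exprAlgebra [DecidableEq X] {t : ℕ} {S : Set X} {hS : S.Nonempty} (x : X)
    {f : ι × (X → Fin n) → ℝ} (hf : f ∈ exprAlgebra Ω G t (insert x S) (Set.insert_nonempty x S)) :
    (fun p => ∑ u, f (p.1, Function.update p.2 x u)) ∈ exprAlgebra Ω G (t + 1) S hS := by
  obtain ⟨φ, h1, h2, h3⟩ := hf
  refine ⟨.sum x φ, Nat.succ_le_succ h1, ?_, fun p => ?_⟩
  · rintro y ⟨hy, hyx⟩
    exact (h2 hy).resolve_left hyx
  · simp only [h3, Expr.eval]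
    refine Finset.sum_congr rfl fun u _ => ?_
    congr!

theorem atp_eq_of_exprAlgebra {t m : ℕ} {S : Set X} {hS : S.Nonempty} {σ : Fin m → X}
    (hσ : ∀ a, σ a ∈ S) {p q : ι × (X → Fin n)}
    (h : ∀ f ∈ exprAlgebra Ω G t S hS, f p = f q) :
    atp (G p.1) (p.2 ∘ σ) = atp (G q.1) (q.2 ∘ σ) := by
  classical
  refine atp_eq_iff.2 ⟨fun i j => ?_, fun i j => ?_, fun i => ?_⟩
  · exact ite_one_zero_eq_iff.1 (h _ (mem_exprAlgebra (φ := .eq (σ i) (σ j)) (Nat.zero_le _)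
      (Set.pair_subset (hσ i) (hσ j))))
  · have hE := h _ (mem_exprAlgebra (φ := .edge (σ i) (σ j)) (Nat.zero_le _)
      (Set.pair_subset (hσ i) (hσ j)))
    simp only [Expr.eval] at hE
    exact ite_one_zero_eq_iff.1 hE
  · funext s
    exact h _ (mem_exprAlgebra (φ := .lab s (σ i)) (Nat.zero_le _)
      (Set.singleton_subset_iff.2 (hσ i)))

/-- The algebra of depth `t` on a set of variables determines the labels after `t` rounds of the
`k`-tuples read off from these variables. The map `σ` need not be injective: this covers the tuples
`(v, …, v)`, and makes `v[u/i]` again a tuple of the form `ν ∘ σ'`. -/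
theorem wl_eq_of_exprAlgebra [Finite ι] {k : ℕ} (t : ℕ) {S : Set (Fin (k + 1))} (hS : S.Nonempty)
    {σ : Fin k → Fin (k + 1)} (hσ : ∀ a, σ a ∈ S)
    {p q : ι × (Fin (k + 1) → Fin n)} (h : ∀ f ∈ exprAlgebra Ω G t S hS, f p = f q) :
    wl k (G p.1) t (p.2 ∘ σ) = wl k (G q.1) t (q.2 ∘ σ) := by
  classical
  induction t generalizing S σ p q with
  | zero => exact atp_eq_of_exprAlgebra hσ h
  | succ t ih =>
    refine Prod.ext (ih hS hσ fun f hf =>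
      h f (exprAlgebra_mono t.le_succ subset_rfl hf)) ?_
    obtain ⟨j, hj⟩ := exists_forall_apply_ne σ
    -- The element that the vertex `p.2 j` contributes to the multiset of the tuple `p.2 ∘ σ`.
    let c : ι × (Fin (k + 1) → Fin n) → AtomicType (k + 1) ℓ × (Fin k → WLLabel k ℓ t) := fun p =>
      (atp (G p.1) (Fin.snoc (p.2 ∘ σ) (p.2 j) : Fin (k + 1) → Fin n),
        fun i => wl k (G p.1) t (Function.update (p.2 ∘ σ) i (p.2 j)))
    have hc : ∀ p q : ι × (Fin (k + 1) → Fin n),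
        (∀ f ∈ exprAlgebra Ω G t (insert j S) (Set.insert_nonempty j S), f p = f q) →
          c p = c q := by
      intro p q hpq
      refine Prod.ext ?_ (funext fun i => ?_)
      · have hs : ∀ η : Fin (k + 1) → Fin n, (Fin.snoc (η ∘ σ) (η j) : Fin (k + 1) → Fin n) =
            η ∘ (Fin.snoc σ j : Fin (k + 1) → Fin (k + 1)) := by
          intro η
          funext a
          refine Fin.lastCases ?_ (fun a => ?_) a <;> simp
        simp only [c, hs]
        refine atp_eq_of_exprAlgebra (fun a => ?_) hpq
        refine Fin.lastCases ?_ (fun a => ?_) a <;> simp [hσ]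
      · have hs : ∀ η : Fin (k + 1) → Fin n, Function.update (η ∘ σ) i (η j) =
            η ∘ Function.update σ i j := fun η => (Function.comp_update η σ i j).symm
        simp only [c, hs]
        refine ih (S := Set.range (Function.update σ i j)) ⟨_, i, rfl⟩ (fun a => ⟨a, rfl⟩)
          fun f hf => hpq f (exprAlgebra_mono le_rfl ?_ hf)
        rintro _ ⟨a, rfl⟩
        by_cases ha : a = i
        · subst ha; simp
        · simp [ha, hσ]
    have hcu : ∀ (p : ι × (Fin (k + 1) → Fin n)) (u : Fin n), c (p.1, Function.update p.2 j u) =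
        (atp (G p.1) (Fin.snoc (p.2 ∘ σ) u : Fin (k + 1) → Fin n),
          fun i => wl k (G p.1) t (Function.update (p.2 ∘ σ) i u)) := by
      intro p u
      have : Function.update p.2 j u ∘ σ = p.2 ∘ σ := by
        funext a
        simp [hj a]
      simp [c, this]
    suffices hms : (Finset.univ.val.map fun u => c (p.1, Function.update p.2 j u)) =
        Finset.univ.val.map fun u => c (q.1, Function.update q.2 j u) by
      simp only [hcu] at hms
      exact hms
    refine Multiset.ext.2 fun b => ?_
    have hmem : (fun p => if c p = b then (1 : ℝ) else 0) ∈
        exprAlgebra Ω G t (insert j S) (Set.insert_nonempty j S) :=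
      Subalgebra.mem_of_forall_eq _ _ fun p q hpq => by rw [hc p q hpq]
    have := h _ (sum_mem_exprAlgebra (hS := hS) j hmem)
    refine Nat.cast_injective (R := ℝ) ?_
    rw [natCast_count_map_univ, natCast_count_map_univ]
    convert this

end Algebra

end TensorLang

theorem theorem2 (n ℓ t k : ℕ) (hk : 1 ≤ k) (Ω : (p : ℕ) → Set ((Fin p → ℝ) → ℝ)) :
    TensorLang.rho1 (fun _ : Unit => TensorLang.vwl (n := n) (ℓ := ℓ) k t) =
      TensorLang.rho1Frag n (TensorLang.TLFrag ℓ (k + 1) t Ω) (0 : Fin (k + 1)) := by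
  open TensorLang in
  refine Setoid.ext fun p q => ⟨fun h => ?_, fun h _ => ?_⟩
  · obtain ⟨G, v⟩ := p
    obtain ⟨H, w⟩ := q
    rintro ⟨⟨d, f⟩, φ, hφ, hf⟩
    funext j
    have hwl : wl k G t (fun _ => v) = wl k H t (fun _ => w) := h ()
    have hatp := atp_comp_eq (atp_eq_of_wl_eq hwl) (fun _ : Fin (k + 1) => (⟨0, hk⟩ : Fin k))
    exact (hf G v (fun _ => v) rfl j).trans <|
      (Expr.eval_eq_of_wl_eq (φ j) (hφ j).1 hatp fun _ => hwl).trans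
        (hf H w (fun _ => w) rfl j).symm
  · let G : Bool → LGraph n ℓ := fun b => if b then p.1 else q.1
    refine wl_eq_of_exprAlgebra (Ω := Ω) (G := G) t (Set.singleton_nonempty (0 : Fin (k + 1)))
      (σ := fun _ => 0) (fun _ => rfl)
      (p := (true, fun _ => p.2)) (q := (false, fun _ => q.2)) ?_
    rintro f ⟨φ, hsd, hfree, hφ⟩
    rw [hφ, hφ]
    -- Multiplication by `1_{x₁ = x₁}` makes the set of free variables equal to `{x₁}`.
    have hrep : Represented (TLFrag ℓ (k + 1) t Ω) (0 : Fin (k + 1))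
        (fun (r : PGraph n ℓ) (_ : Fin 1) => φ.eval r.1 fun _ => r.2) := by
      refine ⟨fun _ => .mul φ (.eq 0 0), fun _ => ⟨max_le hsd (Nat.zero_le _), ?_⟩, ?_⟩
      · exact (congrArg (φ.free ∪ ·) (Set.pair_eq_singleton 0)).trans (Set.union_eq_right.2 hfree)
      · rintro K v ν hν -
        have : φ.eval K (fun _ => v) = φ.eval K ν :=
          φ.eval_congr fun x hx => by rw [hfree hx, hν]
        simp [Expr.eval, this]
    exact congrFun (h ⟨⟨1, _⟩, hrep⟩) 0
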